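/- Let $(W,S)$ be a Coxeter system of type $A_n$, that is, $S=\{s_1,\dots,s_n\}$ and $$W=\langle s_1,\dots,s_n \mid s_i^2=e,\ (s_is_{i+1})^3=e,\ (s_is_j)^2=e \text{ for } |i-j|>1\rangle .$$ Let $\ell$ be the length function of $W$ with respect to $S$ and let $T=\bigcup_{w\in W}wSw^{-1}$ be the set of reflections. For $w\in W$ let $N(w)=\{t\in T : \ell(tw)<\ell(w)\}$ be the inversion set of $w$. Let $\leq_R$ be the right weak order on $W$: $u\leq_R v$ if and only if $\ell(v)=\ell(u)+\ell(u^{-1}v)$. For $A\subseteq T$, an $A$-path is a finite (possibly empty) sequence of steps $x\to xt$ with $t\in A$ and $\ell(x)<\ell(xt)$, and the (right) Bruhat preclosure of $A$ is $$\overline{A}=\{t\in T : \text{there exists an } A\text{-path from } e \text{ to } t\}.$$ Then for all $u,v\in W$ the join (least upper bound) $u\vee_R v$ with respect to $\leq_R$ exists, and $$N(u\vee_R v)=\overline{N(u)\cup N(v)} .$$ -/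

import Mathlib

namespace CoxeterSystem

variable {B W : Type*} [Group W] {M : CoxeterMatrix B}

/-- The inversion set `N(w)`: the reflections `t` with `ℓ(tw) < ℓ(w)`. -/
def inversionSet (cs : CoxeterSystem M W) (w : W) : Set W :=
  {t | cs.IsReflection t ∧ cs.length (t * w) < cs.length w}

/-- The (right) weak order: `u ≤ v` if and only if `ℓ(v) = ℓ(u) + ℓ(u⁻¹v)`. It is a definition
and not an instance, since it depends on the Coxeter system. -/
@[reducible]
def rightWeakOrder (cs : CoxeterSystem M W) : PartialOrder W where
  le u v := cs.length v = cs.length u + cs.length (u⁻¹ * v)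
  le_refl u := by simp
  le_trans u v w huv hvw := by
    have h1 := cs.length_mul_le (u⁻¹ * v) (v⁻¹ * w)
    have h2 := cs.length_mul_le u (u⁻¹ * w)
    simp only [mul_assoc, mul_inv_cancel_left] at h1 h2
    omega
  le_antisymm u v huv hvu := by
    have h : cs.length (u⁻¹ * v) = 0 := by omega
    exact inv_mul_eq_one.mp (cs.length_eq_zero_iff.mp h)

/-- `j` is the join of `u` and `v` in the right weak order, i.e. their least upper bound. -/
def IsRightJoin (cs : CoxeterSystem M W) (u v j : W) : Prop :=
  @IsLUB W cs.rightWeakOrder.toLE {u, v} j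

/-- The directed edge `x ⟶ y` of the Bruhat graph with label `t`: here `t` is a reflection,
`y = xt` and `ℓ(x) < ℓ(y)`. -/
def BruhatEdge (cs : CoxeterSystem M W) (t x y : W) : Prop :=
  cs.IsReflection t ∧ y = x * t ∧ cs.length x < cs.length y

/-- There is a right `A`-path from `x` to `y`: a finite (possibly empty) directed path in the
Bruhat graph all of whose edges are labelled by elements of `A`. -/
def ExistsPath (cs : CoxeterSystem M W) (A : Set W) (x y : W) : Prop :=
  Relation.ReflTransGen (fun a b => ∃ t ∈ A, cs.BruhatEdge t a b) x y

/-- The (right) Bruhat preclosure of a set `A` of reflections: the reflections that can be reached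
from the identity by a right `A`-path. -/
def bruhatPreclosure (cs : CoxeterSystem M W) (A : Set W) : Set W :=
  {t | cs.IsReflection t ∧ cs.ExistsPath A 1 t}

end CoxeterSystem

namespace CoxeterSystem

open Equiv

variable {W : Type*} [Group W] {n : ℕ} (cs : CoxeterSystem (CoxeterMatrix.A n) W)

/-! The group is identified with the permutations of `n + 1` letters. Reflections become
transpositions, and the swap of `a < b` is an inversion of `w` exactly when `w⁻¹ b < w⁻¹ a`
(`mem_inversionSet_iff`); the weak order is inclusion of inversion sets (`rightWeakOrder_le_iff`).

Read `A = N(u) ∪ N(v)` as a set of pairs. Its transitive closure is also coclosed, hence is `N(j)`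
for some `j` (`Fin.exists_perm_of_biclosed`). A chain of pairs in `A` yields a palindromic `A`-path,
so `N(j)` lies in the preclosure of `A` (`existsPath_of_transGen`). Conversely, every `N(k)`
contains its own preclosure (`bruhatPreclosure_inversionSet_subset`). Hence `N(j)` equals the
preclosure of `A` and lies in each `N(k)` containing `A`, which makes `j` the join. -/

/-! ### Isomorphism with the symmetric group -/

theorem isLiftable_swap (n : ℕ) :
    (CoxeterMatrix.A n).IsLiftable (fun i : Fin n => swap i.castSucc i.succ) := by
  intro i j
  simp only [CoxeterMatrix.A, Matrix.of_apply]
  split_ifs with h1 h2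
  · subst h1
    simp
  · rcases h2 with h2 | h2
    · have e : i.castSucc = j.succ := Fin.ext (by simp [← h2])
      rw [e, swap_comm j.castSucc]
      exact (Perm.isThreeCycle_swap_mul_swap_same (by rw [← e]; exact (Fin.castSucc_lt_succ).ne)
        (Fin.castSucc_lt_succ).ne' (by simp [Fin.ext_iff]; omega)).orderOf ▸ pow_orderOf_eq_one _
    · have e : i.succ = j.castSucc := Fin.ext (by simp [← h2])
      rw [← e, swap_comm i.castSucc]
      exact (Perm.isThreeCycle_swap_mul_swap_same (Fin.castSucc_lt_succ).ne'
        (by rw [e]; exact (Fin.castSucc_lt_succ).ne)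
        (by simp [Fin.ext_iff]; omega)).orderOf ▸ pow_orderOf_eq_one _
  · have hd : Perm.Disjoint (swap i.castSucc i.succ) (swap j.castSucc j.succ) := by
      rw [Perm.disjoint_iff_disjoint_support, Perm.support_swap (Fin.castSucc_lt_succ).ne,
        Perm.support_swap (Fin.castSucc_lt_succ).ne]
      simp only [Fin.ext_iff] at h1
      simp [Fin.ext_iff]
      omega
    rw [hd.commute.mul_pow]
    simp [pow_two]

/-- The action of the Coxeter group of type `A n` on `n + 1` letters. -/
def permHom : W →* Perm (Fin (n + 1)) :=
  cs.lift ⟨_, isLiftable_swap n⟩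

@[simp]
theorem permHom_simple (i : Fin n) : cs.permHom (cs.simple i) = swap i.castSucc i.succ :=
  cs.lift_apply_simple _ _

theorem permHom_surjective : Function.Surjective cs.permHom := by
  rw [← MonoidHom.mrange_eq_top, eq_top_iff, ← Perm.mclosure_swap_castSucc_succ,
    Submonoid.closure_le]
  rintro _ ⟨i, rfl⟩
  exact ⟨cs.simple i, cs.permHom_simple i⟩

theorem commute_simple {i j : Fin n} (h : (i : ℕ) + 1 < j) :
    Commute (cs.simple i) (cs.simple j) := by
  have := cs.simple_mul_simple_pow i j
  have hM : CoxeterMatrix.A n i j = 2 := by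
    simp only [CoxeterMatrix.A, Matrix.of_apply]
    rw [if_neg (by rintro rfl; omega), if_neg (by omega)]
  rw [hM, pow_two, mul_eq_one_iff_eq_inv, mul_inv_rev, cs.inv_simple, cs.inv_simple] at this
  exact this

theorem simple_mul_simple_mul_simple {i j : Fin n} (h : (i : ℕ) + 1 = j) :
    cs.simple j * cs.simple i * cs.simple j = cs.simple i * cs.simple j * cs.simple i := by
  have := cs.simple_mul_simple_pow j i
  have hM : CoxeterMatrix.A n j i = 3 := by
    simp only [CoxeterMatrix.A, Matrix.of_apply]
    rw [if_neg (by rintro rfl; omega), if_pos (by omega)]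
  rw [hM, pow_succ, pow_two] at this
  calc _ = (cs.simple j * cs.simple i * (cs.simple j * cs.simple i) *
        (cs.simple j * cs.simple i)) * (cs.simple i * cs.simple j * cs.simple i) := by
        simp [mul_assoc]
    _ = _ := by rw [this, one_mul]

/-- The standard parabolic subgroup generated by the first `k` simple reflections. -/
def initialParabolic (k : ℕ) : Subgroup W :=
  Subgroup.closure {x | ∃ i : Fin n, (i : ℕ) < k ∧ cs.simple i = x}

variable {cs} in
theorem simple_mem_initialParabolic {k : ℕ} {i : Fin n} (h : (i : ℕ) < k) :
    cs.simple i ∈ cs.initialParabolic k :=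
  Subgroup.subset_closure ⟨i, h, rfl⟩

theorem initialParabolic_mono {k m : ℕ} (h : k ≤ m) :
    cs.initialParabolic k ≤ cs.initialParabolic m :=
  Subgroup.closure_mono fun _ ⟨i, hi, e⟩ => ⟨i, hi.trans_le h, e⟩

theorem initialParabolic_eq_top : cs.initialParabolic n = ⊤ := by
  rw [← cs.subgroup_closure_range_simple, initialParabolic]
  congr 1
  ext x
  simp

theorem commute_simple_of_mem_initialParabolic {k : Fin n} {m : ℕ} (hm : m < k) {c : W}
    (hc : c ∈ cs.initialParabolic m) : Commute (cs.simple k) c := by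
  induction hc using Subgroup.closure_induction with
  | mem x hx =>
    obtain ⟨i, hi, rfl⟩ := hx
    exact (cs.commute_simple (by omega)).symm
  | one => exact Commute.one_right _
  | mul x y _ _ hx hy => exact hx.mul_right hy
  | inv x _ hx => exact hx.inv_right

theorem permHom_apply_of_mem_initialParabolic {k : ℕ} {w : W} (hw : w ∈ cs.initialParabolic k)
    {z : Fin (n + 1)} (hz : k < z) : cs.permHom w z = z := by
  induction hw using Subgroup.closure_induction with
  | mem x hx =>
    obtain ⟨i, hi, rfl⟩ := hx
    rw [permHom_simple]
    exact swap_apply_of_ne_of_ne (by rintro rfl; simp at hz; omega)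
      (by rintro rfl; simp at hz; omega)
  | one => simp
  | mul x y _ _ hx hy => simp [hx, hy]
  | inv x _ hx => rw [map_inv, Perm.inv_eq_iff_eq, hx]

/-- The double coset decomposition of one initial parabolic subgroup by the previous one. -/
theorem mem_initialParabolic_succ (k : ℕ) (hk : k < n) (w : W)
    (hw : w ∈ cs.initialParabolic (k + 1)) :
    w ∈ cs.initialParabolic k ∨
      ∃ a ∈ cs.initialParabolic k, ∃ b ∈ cs.initialParabolic k,
        w = a * cs.simple ⟨k, hk⟩ * b := by
  induction k generalizing w with
  | zero =>
    have hP : ∀ x : W, x ∈ cs.initialParabolic 0 ↔ x = 1 := by simp [initialParabolic]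
    simp only [hP]
    induction hw using Subgroup.closure_induction with
    | mem x hx =>
      obtain ⟨i, hi, rfl⟩ := hx
      refine .inr ⟨1, rfl, 1, rfl, ?_⟩
      have : i = ⟨0, hk⟩ := Fin.ext (by simp at hi ⊢; omega)
      simp [this]
    | one => exact .inl rfl
    | mul x y _ _ hx hy =>
      rcases hx with rfl | ⟨a, rfl, b, rfl, rfl⟩
      · simpa using hy
      · rcases hy with rfl | ⟨a, rfl, b, rfl, rfl⟩
        · exact .inr ⟨1, rfl, 1, rfl, by simp⟩
        · exact .inl (by simp)
    | inv x _ hx =>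
      rcases hx with rfl | ⟨a, rfl, b, rfl, rfl⟩
      · simp
      · exact .inr ⟨1, rfl, 1, rfl, by simp⟩
  | succ k ih =>
    specialize ih (by omega)
    set s := cs.simple ⟨k + 1, hk⟩ with hs
    set H := cs.initialParabolic (k + 1) with hH
    have hr : cs.simple ⟨k, by omega⟩ ∈ H := simple_mem_initialParabolic (by simp)
    have hmono : ∀ c ∈ cs.initialParabolic k, c ∈ H :=
      fun c hc => cs.initialParabolic_mono (Nat.le_succ k) hc
    have hcomm : ∀ c ∈ cs.initialParabolic k, s * c = c * s := fun c hc =>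
      cs.commute_simple_of_mem_initialParabolic (Nat.lt_succ_self k) hc
    have hss : s * s = 1 := cs.simple_mul_simple_self _
    have hbraid : s * cs.simple ⟨k, by omega⟩ * s =
        cs.simple ⟨k, by omega⟩ * s * cs.simple ⟨k, by omega⟩ :=
      cs.simple_mul_simple_mul_simple rfl
    induction hw using Subgroup.closure_induction with
    | mem x hx =>
      obtain ⟨i, hi, rfl⟩ := hx
      rcases Nat.lt_succ_iff_lt_or_eq.mp hi with hi | hi
      · exact .inl (simple_mem_initialParabolic hi)
      · refine .inr ⟨1, H.one_mem, 1, H.one_mem, ?_⟩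
        have : i = ⟨k + 1, hk⟩ := Fin.ext hi
        simp [this, hs]
    | one => exact .inl H.one_mem
    | mul x y _ _ hx hy =>
      rcases hx with hx | ⟨a, ha, b, hb, rfl⟩
      · rcases hy with hy | ⟨a, ha, b, hb, rfl⟩
        · exact .inl (H.mul_mem hx hy)
        · exact .inr ⟨x * a, H.mul_mem hx ha, b, hb, by simp only [mul_assoc]⟩
      · rcases hy with hy | ⟨a', ha', b', hb', rfl⟩
        · exact .inr ⟨a, ha, b * y, H.mul_mem hb hy, by simp only [mul_assoc]⟩
        · have e : a * s * b * (a' * s * b') = a * (s * (b * a') * s) * b' := by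
            simp only [mul_assoc]
          rw [e]
          -- Either `b * a'` commutes with `s` and the two `s` cancel, or a braid move leaves a
          -- single `s`.
          rcases ih (b * a') (H.mul_mem hb ha') with hc | ⟨c, hc, d, hd, hcd⟩
          · rw [hcomm _ hc, mul_assoc _ s s, hss, mul_one]
            exact .inl (H.mul_mem (H.mul_mem ha (hmono _ hc)) hb')
          · refine .inr ⟨a * c * cs.simple ⟨k, by omega⟩,
              H.mul_mem (H.mul_mem ha (hmono _ hc)) hr, cs.simple ⟨k, by omega⟩ * d * b',
              H.mul_mem (H.mul_mem hr (hmono _ hd)) hb', ?_⟩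
            rw [hcd]
            calc _ = a * ((s * c) * cs.simple ⟨k, by omega⟩ * (d * s)) * b' := by
                  simp only [mul_assoc]
              _ = a * c * (s * cs.simple ⟨k, by omega⟩ * s) * d * b' := by
                  rw [hcomm c hc, ← hcomm d hd]
                  simp only [mul_assoc]
              _ = _ := by
                  rw [hbraid]
                  simp only [mul_assoc]
    | inv x _ hx =>
      rcases hx with hx | ⟨a, ha, b, hb, rfl⟩
      · exact .inl (H.inv_mem hx)
      · exact .inr ⟨b⁻¹, H.inv_mem hb, a⁻¹, H.inv_mem ha, by simp [hs, mul_assoc]⟩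

/-- An element `a * s * b` of the double coset cannot act trivially: `a` and `b` fix the top letter,
while `s` moves it. -/
theorem permHom_injective : Function.Injective cs.permHom := by
  rw [injective_iff_map_eq_one]
  suffices h : ∀ k ≤ n, ∀ w ∈ cs.initialParabolic k, cs.permHom w = 1 → w = 1 from
    fun w => h n le_rfl w (by simp [cs.initialParabolic_eq_top])
  intro k
  induction k with
  | zero => simp [initialParabolic]
  | succ k ih =>
    intro hk w hw h1
    rcases cs.mem_initialParabolic_succ k hk w hw with hw | ⟨a, ha, b, hb, rfl⟩
    · exact ih (by omega) w hw h1
    · exfalso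
      have hb' := cs.permHom_apply_of_mem_initialParabolic hb
        (z := (⟨k, hk⟩ : Fin n).succ) (by simp)
      have ha' := cs.permHom_apply_of_mem_initialParabolic ha
        (z := (⟨k, hk⟩ : Fin n).succ) (by simp)
      have h2 := congrArg (fun σ => σ (⟨k, hk⟩ : Fin n).succ) h1
      simp only [map_mul, Perm.mul_apply, permHom_simple, hb', swap_apply_right,
        Perm.one_apply] at h2
      exact (Fin.castSucc_lt_succ).ne ((cs.permHom a).injective (h2.trans ha'.symm))

/-! ### Inversions as pairs -/

theorem swap_castSucc_succ_lt {i : Fin n} {a b : Fin (n + 1)} (hab : a < b)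
    (h : ¬(a = i.castSucc ∧ b = i.succ)) :
    swap i.castSucc i.succ a < swap i.castSucc i.succ b := by
  simp only [swap_apply_def]
  simp only [Fin.ext_iff, Fin.lt_def] at *
  split_ifs <;> simp at * <;> omega

/-- The first letter of the word reverses only its own adjacent pair; any other pair keeps its
order, and induction applies after conjugation by that letter. -/
theorem exists_mem_leftInvSeq (ω : List (Fin n)) {a b : Fin (n + 1)} (hab : a < b)
    (h : (cs.permHom (cs.wordProd ω))⁻¹ b < (cs.permHom (cs.wordProd ω))⁻¹ a) :
    ∃ t ∈ cs.leftInvSeq ω, cs.permHom t = swap a b := by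
  induction ω generalizing a b with
  | nil => simp at h; exact absurd h hab.not_gt
  | cons i ω ih =>
    by_cases hi : a = i.castSucc ∧ b = i.succ
    · exact ⟨cs.simple i, by simp [leftInvSeq], by rw [permHom_simple, hi.1, hi.2]⟩
    · obtain ⟨t, ht, e⟩ := ih (swap_castSucc_succ_lt hab hi)
        (by simpa [wordProd_cons] using h)
      refine ⟨_, List.mem_cons_of_mem _ (List.mem_map_of_mem ht), ?_⟩
      rw [MulAut.conj_apply, map_mul, map_mul, e, map_inv, permHom_simple, ← swap_apply_apply]
      simp

theorem exists_permHom_eq_swap {t : W} (ht : cs.IsReflection t) :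
    ∃ a b, a < b ∧ cs.permHom t = swap a b := by
  obtain ⟨w, i, rfl⟩ := ht
  rw [map_mul, map_mul, map_inv, permHom_simple, ← swap_apply_apply]
  rcases lt_or_gt_of_ne ((cs.permHom w).injective.ne (Fin.castSucc_lt_succ (i := i)).ne) with h | h
  · exact ⟨_, _, h, rfl⟩
  · exact ⟨_, _, h, swap_comm _ _⟩

theorem isLeftInversion_of_permHom {t w : W} {a b : Fin (n + 1)} (hab : a < b)
    (ht : cs.permHom t = swap a b) (h : (cs.permHom w)⁻¹ b < (cs.permHom w)⁻¹ a) :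
    cs.IsLeftInversion w t := by
  obtain ⟨ω, hω, rfl⟩ := cs.exists_isReduced w
  obtain ⟨t', ht', e⟩ := cs.exists_mem_leftInvSeq ω hab h
  obtain rfl := cs.permHom_injective (e.trans ht.symm)
  exact cs.isLeftInversion_of_mem_leftInvSeq hω ht'

theorem isReflection_of_permHom {t : W} {a b : Fin (n + 1)} (hab : a < b)
    (ht : cs.permHom t = swap a b) : cs.IsReflection t :=
  (cs.isLeftInversion_of_permHom (w := t) hab ht (by simpa [ht] using hab)).1

theorem length_mul_lt_iff {t : W} {a b : Fin (n + 1)} (hab : a < b)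
    (ht : cs.permHom t = swap a b) (w : W) :
    cs.length (t * w) < cs.length w ↔ (cs.permHom w)⁻¹ b < (cs.permHom w)⁻¹ a := by
  refine ⟨fun h => ?_, fun h => (cs.isLeftInversion_of_permHom hab ht h).2⟩
  by_contra hn
  -- A pair not inverted by `w` is inverted by `t * w`, so multiplying by `t` again shortens.
  have hlt := (not_lt.mp hn).lt_of_ne ((cs.permHom w)⁻¹.injective.ne hab.ne)
  have := (cs.isLeftInversion_of_permHom (w := t * w) hab ht (by simpa [ht] using hlt)).2
  rw [← mul_assoc, (cs.isReflection_of_permHom hab ht).mul_self, one_mul] at this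
  exact absurd h this.not_gt

theorem mem_inversionSet_iff {t w : W} {a b : Fin (n + 1)} (hab : a < b)
    (ht : cs.permHom t = swap a b) :
    t ∈ cs.inversionSet w ↔ (cs.permHom w)⁻¹ b < (cs.permHom w)⁻¹ a := by
  rw [← cs.length_mul_lt_iff hab ht]
  exact and_iff_right (cs.isReflection_of_permHom hab ht)

theorem length_lt_mul_iff {t : W} {a b : Fin (n + 1)} (hab : a < b)
    (ht : cs.permHom t = swap a b) (x : W) :
    cs.length x < cs.length (x * t) ↔ cs.permHom x a < cs.permHom x b := by
  have hr := cs.isReflection_of_permHom hab ht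
  have h := cs.length_mul_lt_iff hab ht x⁻¹
  rw [← cs.length_inv, mul_inv_rev, inv_inv, hr.inv, cs.length_inv, map_inv, inv_inv] at h
  rw [← not_iff_not, not_lt, not_lt, (hr.length_mul_left_ne x).le_iff_lt, h,
    ((cs.permHom x).injective.ne hab.ne').le_iff_lt]

/-! ### The weak order -/

theorem inversionSet_subset_of_le {u v : W}
    (h : cs.length v = cs.length u + cs.length (u⁻¹ * v)) :
    cs.inversionSet u ⊆ cs.inversionSet v := by
  rintro t ⟨ht, hlt⟩
  refine ⟨ht, ?_⟩
  have := cs.length_mul_le (t * u) (u⁻¹ * v)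
  simp only [mul_assoc, mul_inv_cancel_left] at this
  omega

theorem mem_inversionSet_simple_mul {i : Fin n} {t w : W} (ht : cs.IsReflection t)
    (hne : t ≠ cs.simple i) :
    t ∈ cs.inversionSet (cs.simple i * w) ↔
      cs.simple i * t * cs.simple i ∈ cs.inversionSet w := by
  obtain ⟨a, b, hab, e⟩ := cs.exists_permHom_eq_swap ht
  have h : ¬(a = i.castSucc ∧ b = i.succ) := by
    rintro ⟨rfl, rfl⟩
    exact hne (cs.permHom_injective (by rw [e, permHom_simple]))
  rw [cs.mem_inversionSet_iff hab e, cs.mem_inversionSet_iff (swap_castSucc_succ_lt hab h)]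
  · simp
  · rw [map_mul, map_mul, e, permHom_simple, swap_apply_apply, swap_inv]

/-- A left descent of `u` is one of `v`; cancelling it from both preserves the inclusion. -/
theorem le_of_inversionSet_subset {u v : W} (h : cs.inversionSet u ⊆ cs.inversionSet v) :
    cs.length v = cs.length u + cs.length (u⁻¹ * v) := by
  induction hm : cs.length u generalizing u v with
  | zero =>
    obtain rfl := cs.length_eq_zero_iff.mp hm
    simp
  | succ m ih =>
    obtain ⟨i, hi⟩ := cs.exists_leftDescent_of_ne_one (w := u) (by rintro rfl; simp at hm)
    have hiv : cs.IsLeftDescent v i := (h ⟨cs.isReflection_simple i, hi⟩).2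
    rw [isLeftDescent_iff] at hi hiv
    have key := ih (u := cs.simple i * u) (v := cs.simple i * v) ?_ (by omega)
    · simp [mul_assoc] at key
      omega
    · rintro t ⟨ht, hlt⟩
      have hne : t ≠ cs.simple i := by
        rintro rfl
        simp at hlt
        omega
      rw [cs.mem_inversionSet_simple_mul ht hne]
      apply h
      rw [← cs.mem_inversionSet_simple_mul ht hne]
      exact ⟨ht, hlt⟩

theorem rightWeakOrder_le_iff {u v : W} :
    cs.rightWeakOrder.le u v ↔ cs.inversionSet u ⊆ cs.inversionSet v :=
  ⟨cs.inversionSet_subset_of_le, cs.le_of_inversionSet_subset⟩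

end CoxeterSystem

/-! ### Biclosed relations -/

/-- A biclosed set of pairs `a < b` is the inversion set of a permutation. -/
theorem Fin.exists_perm_of_biclosed {m : ℕ} {R : Fin m → Fin m → Prop}
    (hlt : ∀ a b, R a b → a < b) (htrans : ∀ a b c, R a b → R b c → R a c)
    (hco : ∀ a b c, a < b → b < c → R a c → R a b ∨ R b c) :
    ∃ σ : Equiv.Perm (Fin m), ∀ a b, a < b → (σ⁻¹ b < σ⁻¹ a ↔ R a b) := by
  classical
  -- The usual order with the pairs of `R` reversed. Biclosedness makes it transitive, and `σ⁻¹`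
  -- will be the rank function `f`.
  let L : Fin m → Fin m → Prop := fun a b => (a < b ∧ ¬R a b) ∨ R b a
  have hirr : ∀ a, ¬L a a := by
    rintro a (⟨h, _⟩ | h)
    · exact h.false
    · exact (hlt _ _ h).false
  have hL : ∀ a b c, L a b → L b c → L a c := by
    rintro a b c (⟨h1, h2⟩ | h1) (⟨h3, h4⟩ | h3)
    · exact .inl ⟨h1.trans h3, fun h => (hco _ _ _ h1 h3 h).elim h2 h4⟩
    · rcases lt_trichotomy a c with h | rfl | h
      · exact .inl ⟨h, fun h' => h2 (htrans _ _ _ h' h3)⟩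
      · exact absurd h3 h2
      · exact .inr ((hco _ _ _ h h1 h3).resolve_right h2)
    · rcases lt_trichotomy a c with h | rfl | h
      · exact .inl ⟨h, fun h' => h4 (htrans _ _ _ h1 h')⟩
      · exact absurd h1 h4
      · exact .inr ((hco _ _ _ h3 h h1).resolve_left h4)
    · exact .inr (htrans _ _ _ h3 h1)
  let f : Fin m → Fin m := fun a =>
    ⟨(Finset.univ.filter (L · a)).card, by
      simpa using Finset.card_lt_univ_of_notMem (x := a) (by simpa using hirr a)⟩
  have hf : ∀ a b, L a b → f a < f b := fun a b h => by
    rw [Fin.lt_def]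
    refine Finset.card_lt_card (?_ : Finset.univ.filter (L · a) ⊂ Finset.univ.filter (L · b))
    rw [Finset.ssubset_iff_of_subset fun c hc => by
      rw [Finset.mem_filter_univ] at hc ⊢
      exact hL _ _ _ hc h]
    refine ⟨a, ?_, ?_⟩
    · rwa [Finset.mem_filter_univ]
    · rw [Finset.mem_filter_univ]
      exact hirr a
  have htot : ∀ a b, a < b → L a b ∨ L b a := fun a b h => by
    by_cases hR : R a b
    · exact .inr (.inr hR)
    · exact .inl (.inl ⟨h, hR⟩)
  have hinj : Function.Injective f := by
    intro a b e
    by_contra hne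
    have : L a b ∨ L b a := (lt_or_gt_of_ne hne).elim (htot a b) fun h => (htot b a h).symm
    exact this.elim (fun h => (hf _ _ h).ne e) fun h => (hf _ _ h).ne' e
  refine ⟨(Equiv.ofBijective f (Finite.injective_iff_bijective.mp hinj))⁻¹, fun a b hab => ?_⟩
  rw [inv_inv, Equiv.ofBijective_apply, Equiv.ofBijective_apply]
  refine ⟨fun h => ?_, fun h => hf _ _ (.inr h)⟩
  by_contra hR
  exact (hf a b (.inl ⟨hab, hR⟩)).not_gt h

/-- If the chain does not visit `b`, some step jumps over it, and coclosedness of `R` splits that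
step. -/
theorem Relation.TransGen.or_of_between {α : Type*} [LinearOrder α] {R : α → α → Prop}
    (hco : ∀ a b c, a < b → b < c → R a c → R a b ∨ R b c) {a b c : α} (hab : a < b)
    (hbc : b < c) (h : Relation.TransGen R a c) :
    Relation.TransGen R a b ∨ Relation.TransGen R b c := by
  induction h with
  | single h => exact (hco _ _ _ hab hbc h).imp .single .single
  | @tail d c hd h ih =>
    rcases lt_trichotomy b d with hbd | rfl | hdb
    · exact (ih hbd).imp_right (.tail · h)
    · exact .inl hd
    · exact (hco _ _ _ hdb hbc h).imp hd.tail .single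

namespace CoxeterSystem

open Equiv

variable {W : Type*} [Group W] {n : ℕ} (cs : CoxeterSystem (CoxeterMatrix.A n) W)

/-! ### Paths in the Bruhat graph -/

/-- A step `x → x * t` multiplies `x * j` on the left by `x * t * x⁻¹`. This swaps `x a < x b`, a
pair inverted by `x * j` because `j` inverts `a < b`. -/
theorem length_mul_le_of_existsPath {j x : W} (h : cs.ExistsPath (cs.inversionSet j) 1 x) :
    cs.length (x * j) ≤ cs.length j := by
  induction h with
  | refl => simp
  | @tail x y _ h ih =>
    obtain ⟨t, htj, ht, rfl, hlt⟩ := h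
    obtain ⟨a, b, hab, e⟩ := cs.exists_permHom_eq_swap ht
    rw [cs.length_lt_mul_iff hab e] at hlt
    rw [cs.mem_inversionSet_iff hab e] at htj
    refine le_trans (le_of_lt ?_) ih
    have e' : cs.permHom (x * t * x⁻¹) = swap (cs.permHom x a) (cs.permHom x b) := by
      rw [map_mul, map_mul, map_inv, e, swap_apply_apply]
    have := (cs.length_mul_lt_iff hlt e' (x * j)).mpr (by simpa using htj)
    simpa [mul_assoc] using this

theorem bruhatPreclosure_inversionSet_subset (j : W) :
    cs.bruhatPreclosure (cs.inversionSet j) ⊆ cs.inversionSet j := fun _ ⟨ht, h⟩ =>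
  ⟨ht, (cs.length_mul_le_of_existsPath h).lt_of_ne (ht.length_mul_right_ne j)⟩

variable {cs} in
theorem ExistsPath.mono {A A' : Set W} (h : A ⊆ A') {x y : W} (hxy : cs.ExistsPath A x y) :
    cs.ExistsPath A' x y :=
  Relation.ReflTransGen.mono (fun _ _ ⟨t, ht, he⟩ => ⟨t, h ht, he⟩) _ _ hxy

/-- The elements of `A` acting as a transposition of two letters that are at least `a`. -/
def labelsFrom (A : Set W) (a : Fin (n + 1)) : Set W :=
  {t ∈ A | ∃ p q, a ≤ p ∧ p < q ∧ cs.permHom t = swap p q}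

theorem labelsFrom_anti (A : Set W) {a c : Fin (n + 1)} (h : a ≤ c) :
    cs.labelsFrom A c ⊆ cs.labelsFrom A a :=
  fun _ ⟨ht, p, q, hp, hpq, e⟩ => ⟨ht, p, q, h.trans hp, hpq, e⟩

variable {cs} in
-- The path only moves letters at least `c`, and on these `s` is increasing: it merely lowers `c` to
-- `a`. So every step still ascends after left multiplication by `s`.
theorem ExistsPath.swap_mul {A : Set W} {a c : Fin (n + 1)} (hac : a < c) {s y : W}
    (hs : cs.permHom s = swap a c) (h : cs.ExistsPath (cs.labelsFrom A c) 1 y) :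
    (∀ z < c, cs.permHom y z = z) ∧ cs.ExistsPath (cs.labelsFrom A c) s (s * y) := by
  induction h with
  | refl => exact ⟨by simp, by rw [mul_one]; exact Relation.ReflTransGen.refl⟩
  | @tail x y _ h ih =>
    obtain ⟨hfix, hpath⟩ := ih
    obtain ⟨t, htA, ht, rfl, hlt⟩ := h
    obtain ⟨p, q, hcp, hpq, e⟩ := htA.2
    refine ⟨fun z hz => ?_, hpath.tail ⟨t, htA, ht, by rw [mul_assoc], ?_⟩⟩
    · rw [map_mul, e, Perm.mul_apply, swap_apply_of_ne_of_ne (hz.trans_le hcp).ne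
        (hz.trans (hcp.trans_lt hpq)).ne, hfix z hz]
    · rw [cs.length_lt_mul_iff hpq e] at hlt
      rw [← mul_assoc] at *
      rw [cs.length_lt_mul_iff hpq e, map_mul, hs, Perm.mul_apply, Perm.mul_apply]
      have hp : c ≤ cs.permHom x p := by
        by_contra! hn
        exact ((cs.permHom x).injective (hfix _ hn) ▸ hn).not_ge hcp
      rw [swap_apply_of_ne_of_ne (hac.trans (hp.trans_lt hlt)).ne' (hp.trans_lt hlt).ne']
      rcases hp.eq_or_lt with hp | hp
      · rw [← hp, swap_apply_right]
        exact hac.trans (hp.trans_lt hlt)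
      · rwa [swap_apply_of_ne_of_ne (hac.trans hp).ne' hp.ne']

/-- The reflections obtained by composing transpositions in `A` along an increasing chain lie in
the Bruhat preclosure of `A`. -/
theorem existsPath_of_transGen {A : Set W} {a b : Fin (n + 1)}
    (h : Relation.TransGen (fun p q => p < q ∧ ∃ t ∈ A, cs.permHom t = swap p q) a b) :
    a < b ∧ ∃ t, cs.permHom t = swap a b ∧ cs.ExistsPath (cs.labelsFrom A a) 1 t := by
  have hedge : ∀ {a c : Fin (n + 1)} {s : W}, a < c → cs.permHom s = swap a c →
      cs.BruhatEdge s 1 s := fun hac e =>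
    ⟨cs.isReflection_of_permHom hac e, by simp, by
      simpa using (cs.length_lt_mul_iff hac e 1).mpr (by simpa using hac)⟩
  induction h using Relation.TransGen.head_induction_on with
  | @single a h =>
    obtain ⟨hab, t, ht, e⟩ := h
    exact ⟨hab, t, e, .single ⟨t, ⟨ht, a, b, le_rfl, hab, e⟩, hedge hab e⟩⟩
  | @head a c h _ ih =>
    obtain ⟨hac, s, hsA, hs⟩ := h
    obtain ⟨hcb, t, ht, hpath⟩ := ih
    have hsA' : s ∈ cs.labelsFrom A a := ⟨hsA, a, c, le_rfl, hac, hs⟩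
    -- The path goes to `s`, then follows the translated path to `s * t`, then ends with the label
    -- `s` again.
    refine ⟨hac.trans hcb, s * t * s, ?_, ?_⟩
    · have : swap a b = swap (swap a c c) (swap a c b) := by
        rw [swap_apply_right, swap_apply_of_ne_of_ne (hac.trans hcb).ne' hcb.ne']
      rw [map_mul, map_mul, ht, hs, this, swap_apply_apply, swap_inv]
    · refine .trans (.single ⟨s, hsA', hedge hac hs⟩)
        (.tail ((ExistsPath.swap_mul hac hs hpath).2.mono (cs.labelsFrom_anti A hac.le))
          ⟨s, hsA', cs.isReflection_of_permHom hac hs, rfl, ?_⟩)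
      rw [cs.length_lt_mul_iff hac hs, map_mul, hs, ht, Perm.mul_apply, Perm.mul_apply,
        swap_apply_of_ne_of_ne hac.ne (hac.trans hcb).ne, swap_apply_left, swap_apply_left,
        swap_apply_of_ne_of_ne (hac.trans hcb).ne' hcb.ne']
      exact hcb

end CoxeterSystem

/-! ### Construction of the join -/

open CoxeterSystem in
theorem mainTheorem4 {W : Type*} [Group W] (n : ℕ)
    (cs : CoxeterSystem (CoxeterMatrix.A n) W) (u v : W) :
    ∃ j : W, cs.IsRightJoin u v j ∧
      cs.inversionSet j = cs.bruhatPreclosure (cs.inversionSet u ∪ cs.inversionSet v) := by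
  set A := cs.inversionSet u ∪ cs.inversionSet v with hA
  let R : Fin (n + 1) → Fin (n + 1) → Prop :=
    fun p q => p < q ∧ ∃ t ∈ A, cs.permHom t = Equiv.swap p q
  have hmem : ∀ {w : W} {a b : Fin (n + 1)}, a < b →
      ((∃ t ∈ cs.inversionSet w, cs.permHom t = Equiv.swap a b) ↔
        (cs.permHom w)⁻¹ b < (cs.permHom w)⁻¹ a) := by
    intro w a b hab
    refine ⟨fun ⟨t, ht, e⟩ => (cs.mem_inversionSet_iff hab e).mp ht, fun h => ?_⟩
    obtain ⟨t, e⟩ := cs.permHom_surjective (Equiv.swap a b)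
    exact ⟨t, (cs.mem_inversionSet_iff hab e).mpr h, e⟩
  have hR : ∀ a b, R a b ↔ a < b ∧ ((cs.permHom u)⁻¹ b < (cs.permHom u)⁻¹ a ∨
      (cs.permHom v)⁻¹ b < (cs.permHom v)⁻¹ a) := fun a b => and_congr_right fun hab => by
    simp only [hA, Set.mem_union, or_and_right, exists_or, hmem hab]
  obtain ⟨σ, hσ⟩ := Fin.exists_perm_of_biclosed (R := Relation.TransGen R)
    (fun a b h => (cs.existsPath_of_transGen h).1) (fun _ _ _ => Relation.TransGen.trans)
    (fun a b c => Relation.TransGen.or_of_between (fun a b c hab hbc h => by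
      simp only [hR, hab, hbc, true_and] at h ⊢
      -- If neither shorter pair is inverted by `u` or `v`, then each of `u` and `v` preserves the
      -- order of `a` and `c`.
      by_contra! hn
      obtain ⟨-, h | h⟩ := h
      · exact (hn.1.1.trans hn.2.1).not_gt h
      · exact (hn.1.2.trans hn.2.2).not_gt h))
  obtain ⟨j, rfl⟩ := cs.permHom_surjective σ
  have hj : ∀ {t : W} {a b : Fin (n + 1)}, a < b → cs.permHom t = Equiv.swap a b →
      (t ∈ cs.inversionSet j ↔ Relation.TransGen R a b) := fun hab e => by
    rw [cs.mem_inversionSet_iff hab e, hσ _ _ hab]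
  have hAj : A ⊆ cs.inversionSet j := fun t ht => by
    obtain ⟨a, b, hab, e⟩ := cs.exists_permHom_eq_swap (ht.elim And.left And.left)
    exact (hj hab e).mpr (.single ⟨hab, t, ht, e⟩)
  have hjA : cs.inversionSet j ⊆ cs.bruhatPreclosure A := fun t ht => by
    obtain ⟨a, b, hab, e⟩ := cs.exists_permHom_eq_swap ht.1
    obtain ⟨-, t', e', hpath⟩ := cs.existsPath_of_transGen ((hj hab e).mp ht)
    obtain rfl := cs.permHom_injective (e'.trans e.symm)
    exact ⟨ht.1, hpath.mono (Set.sep_subset _ _)⟩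
  have hclosed : ∀ {k : W}, A ⊆ cs.inversionSet k →
      cs.bruhatPreclosure A ⊆ cs.inversionSet k := fun {k} h =>
    fun _ ht => cs.bruhatPreclosure_inversionSet_subset k ⟨ht.1, ht.2.mono h⟩
  refine ⟨j, ⟨?_, fun k hk => ?_⟩, hjA.antisymm (hclosed hAj)⟩
  · rintro w (rfl | rfl)
    · exact cs.rightWeakOrder_le_iff.mpr (Set.subset_union_left.trans hAj)
    · exact cs.rightWeakOrder_le_iff.mpr (Set.subset_union_right.trans hAj)
  · refine cs.rightWeakOrder_le_iff.mpr (hjA.trans (hclosed (Set.union_subset ?_ ?_)))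
    · exact cs.rightWeakOrder_le_iff.mp (hk (Set.mem_insert _ _))
    · exact cs.rightWeakOrder_le_iff.mp (hk (Set.mem_insert_of_mem _ rfl))
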